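/- Let $m\ge 0$ be an integer. A (labeled, rooted, non-plane) tree on the $n$ vertices $1,\dots,n$ is called increasing if the labels along the path from the root to any leaf are increasing; let $T_n(m)$ be the number of increasing trees on $n$ vertices in which every vertex has out-degree at most $m$. For a finite graph $G$ let $\chi_m(G,\lambda)$ be the degree-chromatic polynomial of $G$: the polynomial in $\lambda$ whose value at each integer $\lambda\ge 0$ is the number of colorings of the vertices of $G$ in $\lambda$ colors such that every vertex has at most $m-1$ neighbors of its own color. Let $K_s$ be the complete graph on $s$ vertices, with the convention $\chi_m(K_0,\lambda)=0$. For $n\ge k\ge 0$ let $$B_{n,k}(x_1,\dots,x_{n-k+1})=\sum_{\alpha}\frac{n!}{\alpha_1!\cdots\alpha_{n-k+1}!}\prod_{i=1}^{n-k+1}\left(\frac{x_i}{i!}\right)^{\alpha_i}$$ be the partial Bell polynomial, where the sum is over all sequences $\alpha$ of non-negative integers with $\sum_i\alpha_i=k$ and $\sum_i i\,\alpha_i=n$. Then for every $n\ge 1$ $$T_n(m)=\sum_{k=0}^{n}(-1)^k B_{n+k-1,k}\bigl(\chi_m(K_0,-1),\chi_m(K_1,-1),\dots,\chi_m(K_{n-1},-1)\bigr),$$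 and for every $s\ge 1$ $$\chi_m(K_s,-1)=\sum_{k=1}^{s}(-1)^k\,k!\,B_{s,k}(1_m),$$ where $1_m=(1,\dots,1,0,0,\dots)$ is the sequence with $m$ ones followed by zeros. -/

import Mathlib

open scoped Nat

noncomputable section

namespace IncTree

/-! ### Partial Bell polynomials -/

/-- The partial Bell polynomial `B_{n,k}(x_1, …, x_{n-k+1})`; the value `x i` is the variable `x_i`
(`x 0` is not used). The exponent `α_j` is `α i` with `i = j - 1 : Fin (n - k + 1)`; the sum is over
all `α` with `∑ α_j = k` and `∑ j * α_j = n`. -/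
def partialBell (n k : ℕ) (x : ℕ → ℚ) : ℚ :=
  ∑ α ∈ (Finset.piAntidiag (Finset.univ : Finset (Fin (n - k + 1))) k).filter
      (fun α => ∑ i : Fin (n - k + 1), ((i : ℕ) + 1) * α i = n),
    ((n ! : ℚ) / ∏ i : Fin (n - k + 1), ((α i)! : ℚ)) *
      ∏ i : Fin (n - k + 1), (x ((i : ℕ) + 1) / (((i : ℕ) + 1)! : ℚ)) ^ α i

/-- The sequence `1_m = (1, …, 1, 0, 0, …)` with `m` ones in positions `1, …, m`. -/
def ones (m : ℕ) (i : ℕ) : ℚ := if 1 ≤ i ∧ i ≤ m then 1 else 0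

/-! ### Degree-chromatic polynomials -/

/-- A colouring `c` in which every vertex has at most `m - 1` (that is, fewer than `m`) neighbours of
its own colour. -/
def IsDegreeColoring {V C : Type*} (m : ℕ) (G : SimpleGraph V) (c : V → C) : Prop :=
  ∀ v, {u | G.Adj v u ∧ c u = c v}.ncard < m

/-- The number of such colourings with `l` colours. -/
def degreeColoringCount {V : Type*} (m : ℕ) (G : SimpleGraph V) (l : ℕ) : ℕ :=
  Nat.card {c : V → Fin l // IsDegreeColoring m G c}

/-- The number of such colourings is a polynomial in the number of colours. -/
theorem exists_degreeChromatic {V : Type*} [Finite V] (m : ℕ) (G : SimpleGraph V) :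
    ∃ P : Polynomial ℚ, ∀ l : ℕ, P.eval (l : ℚ) = (degreeColoringCount m G l : ℚ) := by
  classical
  have := Fintype.ofFinite V
  have : Finite (Setoid V) :=
    Finite.of_injective (fun (r : Setoid V) (a b : V) => r a b)
      fun r s h => Setoid.ext fun a b => iff_of_eq (congrFun (congrFun h a) b)
  have := Fintype.ofFinite (Setoid V)
  let ok : Setoid V → Prop := fun r => ∀ v, {u | G.Adj v u ∧ r u v}.ncard < m
  refine ⟨∑ r : {r : Setoid V // ok r}, descPochhammer ℚ (Fintype.card (Quotient r.1)), ?_⟩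
  intro l
  have e1 : {c : V → Fin l // IsDegreeColoring m G c} ≃
      Σ r : {r : Setoid V // ok r}, (Quotient r.1 ↪ Fin l) :=
    { toFun := fun c => ⟨⟨Setoid.ker c.1, fun v => c.2 v⟩,
        ⟨Quotient.lift c.1 (fun _ _ h => h), by
          rintro ⟨a⟩ ⟨b⟩ h
          exact Quotient.sound h⟩⟩
      invFun := fun p => ⟨fun v => p.2 (Quotient.mk _ v), fun v => by
        have h := p.1.2 v
        have hs : {u | G.Adj v u ∧ p.2 (Quotient.mk _ u) = p.2 (Quotient.mk _ v)} =
            {u | G.Adj v u ∧ p.1.1 u v} := by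
          ext u
          simp only [Set.mem_ofPred_eq, p.2.injective.eq_iff]
          exact and_congr_right fun _ => Quotient.eq
        rw [hs]
        exact h⟩
      left_inv := fun c => rfl
      right_inv := by
        rintro ⟨⟨r, hr⟩, f⟩
        have hk : Setoid.ker (fun v => f (Quotient.mk r v)) = r := by
          ext a b
          simp only [Setoid.ker_def, f.injective.eq_iff]
          exact Quotient.eq
        have gen : ∀ (r' : Setoid V) (h' : ok r') (f' : Quotient r' ↪ Fin l), r' = r →
            (∀ v, f' (Quotient.mk r' v) = f (Quotient.mk r v)) →
            (⟨⟨r', h'⟩, f'⟩ : Σ r : {r : Setoid V // ok r}, (Quotient r.1 ↪ Fin l)) =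
              ⟨⟨r, hr⟩, f⟩ := by
          rintro r' h' f' rfl hf
          have : f' = f := by
            ext q
            induction q using Quotient.ind with
            | _ v => rw [hf v]
          rw [this]
        exact gen _ _ _ hk fun v => rfl }
  rw [degreeColoringCount, Nat.card_congr e1, Nat.card_eq_fintype_card, Fintype.card_sigma,
    Polynomial.eval_finsetSum]
  push_cast
  refine Finset.sum_congr rfl fun r _ => ?_
  rw [descPochhammer_eval_eq_descFactorial, Fintype.card_embedding_eq, Fintype.card_fin]

/-- The degree-chromatic polynomial `χ_m(G, λ)`: the (unique) polynomial whose value at every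
natural number `l` is the number of colourings of `G` with `l` colours in which every vertex has at
most `m - 1` neighbours of its own colour. -/
def degreeChromatic {V : Type*} [Finite V] (m : ℕ) (G : SimpleGraph V) : Polynomial ℚ :=
  Classical.choose (exists_degreeChromatic m G)

/-- `χ_m(K_s, λ)`, with the convention `χ_m(K_0, λ) = 0`. -/
def chiComplete (m s : ℕ) : Polynomial ℚ :=
  if s = 0 then 0 else degreeChromatic m (⊤ : SimpleGraph (Fin s))

/-! ### Increasing trees -/

section Trees

variable {n : ℕ}

/-- The children of `v` when the tree `G` is rooted at `r`: the neighbours of `v` that are farther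
from the root. -/
def children (G : SimpleGraph (Fin n)) (r v : Fin n) : Set (Fin n) :=
  {w | G.Adj v w ∧ G.dist r w = G.dist r v + 1}

/-- The out-degree of `v` in the tree `G` rooted at `r`. -/
def outDegree (G : SimpleGraph (Fin n)) (r v : Fin n) : ℕ := (children G r v).ncard

/-- `G` with root `r` is an increasing tree on the labels `Fin n` (the labels are the `n` integers
`0, …, n - 1`): `G` is a tree, and the labels along the path from the root to any leaf
(vertex of out-degree `0`) are increasing. -/
def IsIncreasingTree (G : SimpleGraph (Fin n)) (r : Fin n) : Prop :=
  G.IsTree ∧ ∀ v, outDegree G r v = 0 → ∀ p : G.Walk r v, p.IsPath →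
    p.support.Pairwise (· < ·)

end Trees

/-- `T_n(m)`: the number of increasing trees on `n` vertices in which every vertex has out-degree at
most `m`. A rooted tree is a pair (tree, root). -/
def numIncreasingTrees (n m : ℕ) : ℕ :=
  Nat.card {T : SimpleGraph (Fin n) × Fin n //
    IsIncreasingTree T.1 T.2 ∧ ∀ v, outDegree T.1 T.2 v ≤ m}

end IncTree

end

noncomputable section

namespace IncTree

section Series

open PowerSeries

/-! ### Iterated derivations as generating devices for colourings and trees -/

section Derivations

variable {R A : Type*} [CommSemiring R] [CommSemiring A] [Algebra R A] (D : Derivation R A A)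

/-! Let `f = truncExp m`. Applying `h ↦ f * h'` to a product of derivatives of `f` chooses a factor
to differentiate (a parent) and adjoins a factor `f` (a new vertex). So the constant term of its
`n`-fold iterate on `f` counts the trees on `n + 1` vertices (`card_degree_le`,
`numIncreasingTrees_succ`). With `1 / f = (X * w)'`, Lagrange inversion
(`constantCoeff_iterate_mul_derivative_self`) makes this `n!` times the coefficient of `X ^ n` in
`w⁻¹ ^ (n + 1)`.

Likewise, for `s ≥ 1`, `χ_m(K_s, l)` is `s!` times the coefficient of `X ^ s` in `f ^ l`.
Polynomiality in `l` permits `l = -1` (`chiComplete_eval_neg_one`), so `1 / f`, and hence `w = 1 +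
g`, has the values at `-1` as coefficients. Expanding `(1 + g) ^ (-(n + 1))` in powers of `g`, and
`1 / f` in powers of `f - 1`, gives the two formulas, since Bell polynomials are coefficients of
powers (`partialBell_eq`). -/

theorem derivation_prod_iterate {ι : Type*} [DecidableEq ι] (s : Finset ι) (f : A) (a : ι → ℕ) :
    D (∏ i ∈ s, D^[a i] f) = ∑ i ∈ s, ∏ j ∈ s, D^[a j + if j = i then 1 else 0] f := by
  induction s using Finset.induction_on with
  | empty => simp
  | insert b s hb ih =>
    rw [Finset.prod_insert hb, D.leibniz, ih, Finset.sum_insert hb, Finset.prod_insert hb,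
      add_comm, smul_eq_mul, smul_eq_mul, Finset.mul_sum]
    congr 1
    · rw [if_pos rfl, Function.iterate_succ_apply', mul_comm]
      congr 1
      refine Finset.prod_congr rfl fun j hj => ?_
      rw [if_neg (by rintro rfl; exact hb hj), add_zero]
    · refine Finset.sum_congr rfl fun i hi => ?_
      rw [Finset.prod_insert hb, if_neg (by rintro rfl; exact hb hi), add_zero]

/-- The size of the fibre of `c` over `v`. -/
def fibreCard {n : ℕ} {C : Type*} [DecidableEq C] (c : Fin n → C) (v : C) : ℕ :=
  ∑ i, if v = c i then 1 else 0

/-- Leibniz: each of the `s` differentiations hits one of the `l` factors, and `c` records which. -/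
theorem iterate_derivation_pow (f : A) (s l : ℕ) :
    D^[s] (f ^ l) = ∑ c : Fin s → Fin l, ∏ j, D^[fibreCard c j] f := by
  induction s with
  | zero => simp [fibreCard]
  | succ s ih =>
    rw [Function.iterate_succ_apply', ih, map_sum, ← (Fin.snocEquiv fun _ => Fin l).sum_comp,
      Fintype.sum_prod_type_right]
    refine Finset.sum_congr rfl fun c _ => ?_
    rw [derivation_prod_iterate]
    refine Finset.sum_congr rfl fun i _ => Finset.prod_congr rfl fun j _ => ?_
    simp [fibreCard, Fin.sum_univ_castSucc, -Finset.sum_boole]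

/-- Functions sending each `i + 1` to a strictly smaller parent. -/
abbrev ParentMap (n : ℕ) : Type := (i : Fin n) → Fin ((i : ℕ) + 1)

/-- The number of children of `v`. -/
def ParentMap.degree {n : ℕ} (p : ParentMap n) (v : ℕ) : ℕ :=
  fibreCard (fun i => (p i : ℕ)) v

theorem iterate_mul_derivation (f : A) (n : ℕ) :
    (fun h => f * D h)^[n] f = ∑ p : ParentMap n, ∏ v : Fin (n + 1), D^[p.degree v] f := by
  induction n with
  | zero => simp [ParentMap.degree, fibreCard]
  | succ n ih =>
    rw [Function.iterate_succ_apply', ih, map_sum, Finset.mul_sum,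
      ← (Fin.snocEquiv fun i : Fin (n + 1) => Fin ((i : ℕ) + 1)).sum_comp,
      Fintype.sum_prod_type_right]
    refine Finset.sum_congr rfl fun p _ => ?_
    rw [derivation_prod_iterate, Finset.mul_sum]
    refine Finset.sum_congr rfl fun u _ => ?_
    conv_rhs => rw [Fin.prod_univ_castSucc]
    rw [mul_comm]
    congr 1
    · refine Finset.prod_congr rfl fun j _ => ?_
      simp [ParentMap.degree, fibreCard, Fin.sum_univ_castSucc, Fin.ext_iff, -Finset.sum_boole]
    · have h : ∀ i : Fin n, n + 1 ≠ (p i : ℕ) := fun i => by have := (p i).2; simp at this; omega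
      have h' : n + 1 ≠ (u : ℕ) := by have := u.2; simp at this; omega
      simp [ParentMap.degree, fibreCard, Fin.sum_univ_castSucc, h, h', -Finset.sum_boole]

end Derivations

/-! ### Counting by the truncated exponential -/

/-- The truncated exponential series `∑_{i ≤ m} X ^ i / i!`. -/
def truncExp (m : ℕ) : ℚ⟦X⟧ := mk fun i => if i ≤ m then ((i)! : ℚ)⁻¹ else 0

theorem constantCoeff_iterate_derivative_truncExp (m i : ℕ) :
    constantCoeff ((derivative ℚ)^[i] (truncExp m)) = if i ≤ m then 1 else 0 := by
  rw [constantCoeff_iterate_derivative, truncExp, coeff_mk]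
  split_ifs
  · exact mul_inv_cancel₀ (by positivity)
  · simp

theorem prod_ite_one_zero {ι : Type*} (s : Finset ι) (P : ι → Prop) [DecidablePred P]
    [Decidable (∀ i ∈ s, P i)] :
    (∏ i ∈ s, if P i then (1 : ℚ) else 0) = if ∀ i ∈ s, P i then 1 else 0 :=
  Finset.prod_ite_zero.trans (by simp)

theorem card_fibreCard_le (m s l : ℕ) :
    (Nat.card {c : Fin s → Fin l // ∀ j, fibreCard c j ≤ m} : ℚ) =
      s ! * coeff s (truncExp m ^ l) := by
  classical
  rw [← constantCoeff_iterate_derivative, iterate_derivation_pow]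
  simp [constantCoeff_iterate_derivative_truncExp, prod_ite_one_zero, Nat.card_eq_fintype_card,
    Fintype.card_subtype]

theorem card_degree_le (m n : ℕ) :
    (Nat.card {p : ParentMap n // ∀ v : Fin (n + 1), p.degree v ≤ m} : ℚ) =
      constantCoeff ((fun h => truncExp m * derivative ℚ h)^[n] (truncExp m)) := by
  classical
  rw [iterate_mul_derivation]
  simp [constantCoeff_iterate_derivative_truncExp, prod_ite_one_zero, Nat.card_eq_fintype_card,
    Fintype.card_subtype]

/-! ### Lagrange inversion -/

section Lagrange

variable {f u w : ℚ⟦X⟧}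

/-- Integration by parts for residues: with `φ = X * w`, the residue of `(h / φ ^ (n + 1))'` is
zero. -/
theorem coeff_mul_derivative_X_mul (huw : w * u = 1) (h : ℚ⟦X⟧) (n : ℕ) :
    (n + 1) * coeff (n + 1) (h * derivative ℚ (X * w) * u ^ (n + 2)) =
      coeff n (derivative ℚ h * u ^ (n + 1)) := by
  have hu : derivative ℚ w * u = -(w * derivative ℚ u) := by
    have := congrArg (derivative ℚ) huw
    rw [Derivation.leibniz, derivative_one, smul_eq_mul, smul_eq_mul] at this
    linear_combination this
  have hD : derivative ℚ (u ^ (n + 1)) = (n + 1) * u ^ n * derivative ℚ u := by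
    rw [derivative_pow]; push_cast; simp
  have key : ((n : ℚ⟦X⟧) + 1) * (h * derivative ℚ (X * w) * u ^ (n + 2)) =
      ((n : ℚ⟦X⟧) + 1) * (h * u ^ (n + 1)) - X * (h * derivative ℚ (u ^ (n + 1))) := by
    rw [hD, Derivation.leibniz, derivative_X, smul_eq_mul, smul_eq_mul]
    linear_combination (n + 1) * h * X * u ^ (n + 1) * hu +
      ((n + 1) * h * u ^ (n + 1) - (n + 1) * h * X * u ^ n * derivative ℚ u) * huw
  have key' := congrArg (coeff (n + 1)) key
  have hC : ((n : ℚ⟦X⟧) + 1) = C ((n : ℚ) + 1) := by simp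
  rw [hC, map_sub, coeff_C_mul, coeff_C_mul, coeff_succ_X_mul] at key'
  have hd := coeff_derivative (h * u ^ (n + 1)) n
  rw [Derivation.leibniz, smul_eq_mul, smul_eq_mul, map_add, mul_comm (u ^ _)] at hd
  rw [key']
  linear_combination -hd

/-- Induction peels off the innermost application: `h` becomes `f * h'`, whose `f` cancels `(X *
w)'`. -/
theorem constantCoeff_iterate_mul_derivative (huw : w * u = 1)
    (hf : f * derivative ℚ (X * w) = 1) (h : ℚ⟦X⟧) (n : ℕ) :
    constantCoeff ((fun g => f * derivative ℚ g)^[n] h) =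
      n ! * coeff n (h * derivative ℚ (X * w) * u ^ (n + 1)) := by
  induction n generalizing h with
  | zero =>
    have h1 := congrArg constantCoeff huw
    simp only [map_mul, map_one] at h1
    simp [Derivation.leibniz, mul_assoc, h1]
  | succ n ih =>
    rw [Function.iterate_succ_apply, ih, Nat.factorial_succ, Nat.cast_mul, mul_comm ((n + 1 : ℕ) : ℚ),
      mul_assoc (n ! : ℚ), Nat.cast_succ, coeff_mul_derivative_X_mul huw]
    congr 2
    linear_combination derivative ℚ h * u ^ (n + 1) * hf

/-- Lagrange inversion for the solution of `T' = f(T)`. -/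
theorem constantCoeff_iterate_mul_derivative_self (huw : w * u = 1)
    (hf : f * derivative ℚ (X * w) = 1) (n : ℕ) :
    constantCoeff ((fun g => f * derivative ℚ g)^[n] f) = n ! * coeff n (u ^ (n + 1)) := by
  -- Since `f * X' = f`, iterating on `f` is iterating once more on `X`.
  have h := constantCoeff_iterate_mul_derivative huw hf X (n + 1)
  rw [Function.iterate_succ_apply, derivative_X, mul_one, Nat.factorial_succ, Nat.cast_mul,
    mul_comm ((n + 1 : ℕ) : ℚ), mul_assoc, Nat.cast_succ, coeff_mul_derivative_X_mul huw,
    derivative_X, one_mul] at h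
  exact h

end Lagrange

/-! ### Powers of series and Bell polynomials -/

theorem coeff_pow_eq_zero {g : ℚ⟦X⟧} (hg : constantCoeff g = 0) {n k : ℕ} (h : n < k) :
    coeff n (g ^ k) = 0 :=
  X_pow_dvd_iff.1 (pow_dvd_pow_of_dvd (X_dvd_iff.2 hg) k) n h

/-- Negative binomial series, cut at `K` because `X ^ K ∣ g ^ K`. The truncated identity is one of
polynomials, so `-g` can be substituted by `aeval`. -/
theorem coeff_pow_inverse {g u : ℚ⟦X⟧} (hg : constantCoeff g = 0) (hu : (1 + g) * u = 1)
    (d : ℕ) {n K : ℕ} (hK : n < K) :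
    coeff n (u ^ (d + 1)) =
      ∑ k ∈ Finset.range K, (-1) ^ k * ((d + k).choose d : ℚ) * coeff n (g ^ k) := by
  set S : ℚ⟦X⟧ := mk fun k => ((d + k).choose d : ℚ)
  have hS : S * (1 - X) ^ (d + 1) = 1 := mk_add_choose_mul_one_sub_pow_eq_one ℚ d
  have hdvd : (Polynomial.X : Polynomial ℚ) ^ K ∣
      trunc K S * (1 - Polynomial.X) ^ (d + 1) - 1 := by
    rw [Polynomial.X_pow_dvd_iff]
    intro i hi
    have h1 : ((trunc K S * (1 - Polynomial.X) ^ (d + 1) - 1 : Polynomial ℚ) : ℚ⟦X⟧) =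
        (trunc K S : ℚ⟦X⟧) * (1 - X) ^ (d + 1) - 1 := by simp
    have h2 : coeff i ((trunc K S : ℚ⟦X⟧) * (1 - X) ^ (d + 1)) = coeff i (S * (1 - X) ^ (d + 1)) := by
      rw [coeff_mul_eq_coeff_trunc_mul_trunc _ _ hi, trunc_trunc,
        ← coeff_mul_eq_coeff_trunc_mul_trunc _ _ hi]
    rw [← Polynomial.coeff_coe, h1, map_sub, h2, hS, sub_self]
  obtain ⟨q, hq⟩ := hdvd
  have h2 := congrArg (Polynomial.aeval (-g)) hq
  simp only [map_sub, map_mul, map_pow, map_one, Polynomial.aeval_X, sub_neg_eq_add] at h2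
  have h3 : u ^ (d + 1) = Polynomial.aeval (-g) (trunc K S) -
      (-g) ^ K * (Polynomial.aeval (-g) q * u ^ (d + 1)) := by
    have h4 : (1 + g) ^ (d + 1) * u ^ (d + 1) = 1 := by rw [← mul_pow, hu, one_pow]
    linear_combination (-u ^ (d + 1)) * h2 + (Polynomial.aeval (-g) (trunc K S)) * h4
  have h5 : coeff n ((-g) ^ K * (Polynomial.aeval (-g) q * u ^ (d + 1))) = 0 :=
    X_pow_dvd_iff.1 (Dvd.dvd.mul_right (pow_dvd_pow_of_dvd (X_dvd_iff.2 (by simpa using hg)) K) _)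
      n hK
  rw [h3, map_sub, h5, sub_zero, trunc_apply, map_sum, map_sum, Nat.Ico_zero_eq_range]
  refine Finset.sum_congr rfl fun k _ => ?_
  rw [Polynomial.aeval_monomial, coeff_mk, neg_pow, ← mul_assoc, PowerSeries.algebraMap_apply,
    Algebra.algebraMap_self, RingHom.id_apply, show (-1 : ℚ⟦X⟧) ^ k = C ((-1) ^ k) by simp, ← map_mul,
    coeff_C_mul, mul_comm ((-1 : ℚ) ^ k)]

/-- The series `∑_{i ≥ 0} x_{i+1} X ^ i / (i + 1)!`. -/
def shiftedEGF (x : ℕ → ℚ) : ℚ⟦X⟧ := mk fun i => x (i + 1) / ((i + 1)! : ℚ)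

theorem coeff_pow_eq_coeff_trunc_pow (f : ℚ⟦X⟧) {d n : ℕ} (h : d < n) (k : ℕ) :
    coeff d (f ^ k) = (trunc n f ^ k).coeff d := by
  rw [← Polynomial.coeff_coe, Polynomial.coe_pow, ← coeff_coe_trunc_of_lt h, ← trunc_trunc_pow,
    coeff_coe_trunc_of_lt h]

theorem partialBell_eq {n k : ℕ} (h : k ≤ n) (x : ℕ → ℚ) :
    partialBell n k x = n ! / k ! * coeff (n - k) (shiftedEGF x ^ k) := by
  rw [coeff_pow_eq_coeff_trunc_pow _ (Nat.lt_succ_self (n - k)), trunc_apply, Nat.Ico_zero_eq_range,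
    Finset.sum_range, Finset.sum_pow_eq_sum_piAntidiag, Polynomial.finsetSum_coeff, partialBell,
    Finset.mul_sum, Finset.sum_filter]
  refine Finset.sum_congr rfl fun α hα => ?_
  have hsum : ∑ i, α i = k := (Finset.mem_piAntidiag.1 hα).1
  have hmon : ∀ i : Fin (n - k + 1), Polynomial.monomial (i : ℕ) (coeff (i : ℕ) (shiftedEGF x)) ^ α i =
      Polynomial.C ((x (i + 1) / ((i + 1 : ℕ)! : ℚ)) ^ α i) * Polynomial.X ^ ((i : ℕ) * α i) := by
    intro i
    rw [Polynomial.monomial_pow, Polynomial.C_mul_X_pow_eq_monomial, shiftedEGF, coeff_mk]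
  simp_rw [hmon]
  rw [Finset.prod_mul_distrib, ← map_prod, Finset.prod_pow_eq_pow_sum,
    show ((Nat.multinomial Finset.univ α : ℕ) : Polynomial ℚ) =
      Polynomial.C ((Nat.multinomial Finset.univ α : ℕ) : ℚ) by simp,
    ← mul_assoc, ← map_mul, Polynomial.coeff_C_mul, Polynomial.coeff_X_pow]
  -- The shift by one in the weights costs exactly `∑ α = k`.
  have hiff : ∑ i : Fin (n - k + 1), ((i : ℕ) + 1) * α i = n ↔
      n - k = ∑ i : Fin (n - k + 1), (i : ℕ) * α i := by
    simp_rw [add_mul, one_mul]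
    rw [Finset.sum_add_distrib, hsum]
    omega
  have hmul : ((∏ i, ((α i)! : ℚ)) * (Nat.multinomial Finset.univ α : ℚ)) = (k ! : ℚ) := by
    have := Nat.multinomial_spec Finset.univ α
    rw [hsum] at this
    exact_mod_cast this
  have hne : (∏ i, ((α i)! : ℚ)) ≠ 0 := by positivity
  have hk : (k ! : ℚ) ≠ 0 := by positivity
  simp only [hiff]
  split_ifs
  · rw [mul_one, ← mul_assoc]
    congr 1
    rw [div_mul_eq_mul_div, div_eq_div_iff hne hk, ← hmul]
    ring
  · simp

/-! ### Degree-chromatic polynomials of complete graphs at `-1` -/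

theorem fibreCard_eq_ncard {n : ℕ} {C : Type*} [DecidableEq C] (c : Fin n → C) (v : C) :
    fibreCard c v = {i | c i = v}.ncard := by
  simp [fibreCard, Set.ncard_eq_toFinset_card', eq_comm]

theorem isDegreeColoring_top_iff {m s l : ℕ} (c : Fin s → Fin l) :
    IsDegreeColoring m (⊤ : SimpleGraph (Fin s)) c ↔ ∀ j, fibreCard c j ≤ m := by
  have key : ∀ v, {u | (⊤ : SimpleGraph (Fin s)).Adj v u ∧ c u = c v}.ncard + 1 =
      fibreCard c (c v) := fun v => by
    have hv : v ∈ {i | c i = c v} := rfl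
    have hset : {u | (⊤ : SimpleGraph (Fin s)).Adj v u ∧ c u = c v} = {i | c i = c v} \ {v} := by
      ext u
      simp [and_comm, eq_comm]
    rw [fibreCard_eq_ncard, ← Set.ncard_sdiff_singleton_add_one hv, hset]
  refine ⟨fun h j => ?_, fun h v => ?_⟩
  · by_cases hj : ∃ v, c v = j
    · obtain ⟨v, rfl⟩ := hj
      rw [← key]
      exact h v
    · push Not at hj
      rw [fibreCard_eq_ncard]
      simp [hj]
  · exact Nat.lt_of_succ_le ((key v).trans_le (h _))

theorem chiComplete_eval_natCast {m s : ℕ} (hs : 1 ≤ s) (l : ℕ) :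
    (chiComplete m s).eval (l : ℚ) = s ! * coeff s (truncExp m ^ l) := by
  rw [chiComplete, if_neg (by omega), degreeChromatic,
    Classical.choose_spec (exists_degreeChromatic m (⊤ : SimpleGraph (Fin s))), ← card_fibreCard_le,
    degreeColoringCount]
  simp_rw [isDegreeColoring_top_iff]

theorem constantCoeff_truncExp_sub_one (m : ℕ) : constantCoeff (truncExp m - 1) = 0 := by
  simp [truncExp]

theorem truncExp_sub_one (m : ℕ) : truncExp m - 1 = X * shiftedEGF (ones m) := by
  ext (_ | n)
  · simpa using constantCoeff_truncExp_sub_one m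
  · rw [coeff_succ_X_mul]
    simp [truncExp, shiftedEGF, ones, coeff_one, div_eq_mul_inv]

theorem truncExp_mul_inv (m : ℕ) : truncExp m * (truncExp m)⁻¹ = 1 :=
  PowerSeries.mul_inv_cancel _ (by simp [truncExp])

theorem coeff_inv_truncExp (m s : ℕ) {K : ℕ} (hK : s < K) :
    coeff s (truncExp m)⁻¹ =
      ∑ k ∈ Finset.range K, (-1) ^ k * coeff s ((truncExp m - 1) ^ k) := by
  have := coeff_pow_inverse (constantCoeff_truncExp_sub_one m)
    (u := (truncExp m)⁻¹) (by rw [add_sub_cancel, truncExp_mul_inv]) 0 hK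
  simpa using this

theorem chiComplete_eval_neg_one {m s : ℕ} (hs : 1 ≤ s) :
    (chiComplete m s).eval (-1) = s ! * coeff s (truncExp m)⁻¹ := by
  -- From `f ^ l = (1 + (f - 1)) ^ l`: `l.choose k` is a falling factorial over `k!`, and terms with
  -- `k > s` vanish.
  have hP : chiComplete m s = ∑ k ∈ Finset.range (s + 1),
      Polynomial.C ((s ! : ℚ) * coeff s ((truncExp m - 1) ^ k) / k !) * descPochhammer ℚ k := by
    refine Polynomial.eq_of_infinite_eval_eq _ _
      ((Set.infinite_range_of_injective Nat.cast_injective).mono ?_)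
    rintro _ ⟨l, rfl⟩
    rw [Set.mem_ofPred_eq, chiComplete_eval_natCast hs, Polynomial.eval_finsetSum]
    have h1 : truncExp m ^ l = ∑ k ∈ Finset.range (l + 1),
        (truncExp m - 1) ^ k * (l.choose k : ℚ⟦X⟧) := by
      conv_lhs => rw [← sub_add_cancel (truncExp m) 1, add_pow]
      simp
    have h2 : ∀ k, coeff s ((truncExp m - 1) ^ k * (l.choose k : ℚ⟦X⟧)) =
        coeff s ((truncExp m - 1) ^ k) * (l.choose k : ℚ) := fun k => by
      rw [show (l.choose k : ℚ⟦X⟧) = C (l.choose k : ℚ) by simp, coeff_mul_C]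
    rw [h1, map_sum, Finset.mul_sum]
    have hsub1 : Finset.range (l + 1) ⊆ Finset.range (l + s + 1) := by
      intro; simp; omega
    have hsub2 : Finset.range (s + 1) ⊆ Finset.range (l + s + 1) := by
      intro; simp; omega
    rw [Finset.sum_subset hsub1, Finset.sum_subset hsub2]
    · refine Finset.sum_congr rfl fun k _ => ?_
      rw [h2, Polynomial.eval_mul, Polynomial.eval_C, descPochhammer_eval_eq_descFactorial,
        Nat.descFactorial_eq_factorial_mul_choose]
      push_cast
      field_simp
    · intro k _ hk
      rw [coeff_pow_eq_zero (constantCoeff_truncExp_sub_one m) (by simpa using hk)]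
      simp
    · intro k _ hk
      rw [Nat.choose_eq_zero_of_lt (by simpa using hk)]
      simp
  have hd : ∀ k, (descPochhammer ℚ k).eval (-1) = (-1) ^ k * (k ! : ℚ) := by
    intro k
    induction k with
    | zero => simp
    | succ k ih =>
      rw [descPochhammer_succ_eval, ih, Nat.factorial_succ]
      push_cast
      ring
  rw [hP, Polynomial.eval_finsetSum, coeff_inv_truncExp m s (Nat.lt_succ_self s), Finset.mul_sum]
  refine Finset.sum_congr rfl fun k _ => ?_
  rw [Polynomial.eval_mul, Polynomial.eval_C, hd]
  field_simp

theorem chiComplete_eval_neg_one_eq_sum_partialBell {m s : ℕ} (hs : 1 ≤ s) :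
    (chiComplete m s).eval (-1) =
      ∑ k ∈ Finset.Icc 1 s, (-1) ^ k * (k ! : ℚ) * partialBell s k (ones m) := by
  have hsub : Finset.Icc 1 s ⊆ Finset.range (s + 1) := fun k hk => by
    simp only [Finset.mem_Icc, Finset.mem_range] at hk ⊢; omega
  rw [chiComplete_eval_neg_one hs, coeff_inv_truncExp m s (Nat.lt_succ_self s), Finset.mul_sum,
    ← Finset.sum_subset hsub]
  · refine Finset.sum_congr rfl fun k hk => ?_
    have hks := (Finset.mem_Icc.1 hk).2
    rw [partialBell_eq hks, truncExp_sub_one, mul_pow, coeff_X_pow_mul', if_pos hks]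
    field_simp
  · intro k hk hk'
    obtain rfl : k = 0 := by
      simp only [Finset.mem_Icc, Finset.mem_range] at hk hk'; omega
    simp [coeff_one, show s ≠ 0 by omega]

/-- The convention at `K_0` removes the constant term of the shifted series; the summand `1`
restores it. -/
theorem X_mul_derivative_eq (m : ℕ) :
    truncExp m * derivative ℚ
      (X * (1 + shiftedEGF fun i => (chiComplete m (i - 1)).eval (-1))) = 1 := by
  refine Eq.trans ?_ (truncExp_mul_inv m)
  congr 1
  ext n
  rw [coeff_derivative, coeff_succ_X_mul, map_add, shiftedEGF, coeff_mk, Nat.add_sub_cancel,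
    coeff_one]
  rcases Nat.eq_zero_or_pos n with rfl | hn
  · simp [chiComplete, truncExp]
  · rw [if_neg hn.ne', chiComplete_eval_neg_one hn, Nat.factorial_succ]
    push_cast
    field_simp
    ring

theorem card_degree_le_eq_sum_partialBell (m n : ℕ) :
    (Nat.card {p : ParentMap n // ∀ v : Fin (n + 1), p.degree v ≤ m} : ℚ) =
      ∑ k ∈ Finset.range (n + 2), (-1) ^ k * partialBell (n + k) k
            (fun i => (chiComplete m (i - 1)).eval (-1)) := by
  set g := shiftedEGF fun i => (chiComplete m (i - 1)).eval (-1)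
  have hg : constantCoeff g = 0 := by
    simp [g, shiftedEGF, chiComplete]
  have hu : (1 + g) * (1 + g)⁻¹ = 1 := PowerSeries.mul_inv_cancel _ (by simp [hg])
  rw [card_degree_le, constantCoeff_iterate_mul_derivative_self hu (X_mul_derivative_eq m),
    coeff_pow_inverse hg hu n (K := n + 2) (by omega), Finset.mul_sum]
  refine Finset.sum_congr rfl fun k _ => ?_
  rw [partialBell_eq (by omega), Nat.add_sub_cancel, ← Nat.add_choose_mul_factorial_mul_factorial,
    Nat.choose_symm_add]
  change _ = _ * (_ * coeff n (g ^ k))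
  push_cast
  field_simp

end Series

/-! ### Increasing trees as parent maps -/

section Trees

open SimpleGraph

section Walks

variable {V : Type*} {G : SimpleGraph V}

theorem le_of_pairwise_support [Preorder V] {u v x : V} {p : G.Walk u v}
    (hp : p.support.Pairwise (· < ·)) (hx : x ∈ p.support) : x ≤ v := by
  rw [← p.dropLast_support_concat] at hp hx
  rw [List.pairwise_append] at hp
  rcases List.mem_append.1 hx with hx | hx
  · exact (hp.2.2 x hx v (by simp)).le
  · exact (List.mem_singleton.1 hx).le

theorem ge_of_pairwise_support [Preorder V] {u v x : V} {p : G.Walk u v}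
    (hp : p.support.Pairwise (· < ·)) (hx : x ∈ p.support) : u ≤ x := by
  rw [← p.cons_tail_support] at hp hx
  rw [List.pairwise_cons] at hp
  rcases List.mem_cons.1 hx with rfl | hx
  · exact le_rfl
  · exact (hp.1 x hx).le

theorem penultimate_lt [PartialOrder V] {u v : V} {p : G.Walk u v}
    (hp : p.support.Pairwise (· < ·)) (hnil : ¬ p.Nil) : p.penultimate < v :=
  lt_of_le_of_ne (le_of_pairwise_support hp (p.getVert_mem_support _)) (p.adj_penultimate hnil).ne

/-- A descent would go to the unique smaller neighbour, which is the vertex just left; the first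
step cannot descend from a minimum. -/
theorem pairwise_support_of_isPath [LinearOrder V]
    (hG : ∀ v x y, x < v → y < v → G.Adj x v → G.Adj y v → x = y) {u v : V} (p : G.Walk u v)
    (hp : p.IsPath) (hu : (∀ x, u ≤ x) ∨ ∃ x < u, G.Adj x u ∧ x ∉ p.support) :
    p.support.Pairwise (· < ·) := by
  induction p with
  | nil => simp
  | @cons u w v h q ih =>
    rw [Walk.cons_isPath_iff] at hp
    have huw : u < w := by
      refine lt_of_le_of_ne (le_of_not_gt fun hlt => ?_) h.ne
      rcases hu with hu | ⟨x, hxu, hx, hxs⟩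
      · exact (hu w).not_gt hlt
      · obtain rfl := hG u x w hxu hlt hx h.symm
        simp at hxs
    have hq := ih hp.1 (Or.inr ⟨u, huw, h, hp.2⟩)
    rw [Walk.support_cons, List.pairwise_cons]
    exact ⟨fun x hx => huw.trans_le (ge_of_pairwise_support hq hx), hq⟩

/-- The largest vertex of a cycle would have two distinct smaller neighbours. -/
theorem isAcyclic_of_unique_smaller_neighbor [LinearOrder V]
    (hG : ∀ v x y, x < v → y < v → G.Adj x v → G.Adj y v → x = y) : G.IsAcyclic := by
  classical
  intro u p hp
  obtain ⟨M, hM, hmax⟩ := p.support.toFinset.exists_max_image id ⟨u, by simp⟩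
  rw [List.mem_toFinset] at hM
  have hq := hp.rotate hM
  have hle : ∀ x ∈ (p.rotate M hM).support, x ≤ M := fun x hx => hmax x (by
    rw [List.mem_toFinset]; exact (p.mem_support_rotate_iff M hM).1 hx)
  have h1 := (p.rotate M hM).adj_snd hq.not_nil
  have h2 := (p.rotate M hM).adj_penultimate hq.not_nil
  exact hq.snd_ne_penultimate (hG M _ _ (lt_of_le_of_ne (hle _ (Walk.getVert_mem_support _ _)) h1.ne')
    (lt_of_le_of_ne (hle _ (Walk.getVert_mem_support _ _)) h2.ne) h1.symm h2)

end Walks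

variable {n : ℕ}

/-- Every vertex other than `0` has exactly one smaller neighbour. -/
def IsRecursive (G : SimpleGraph (Fin (n + 1))) : Prop :=
  ∀ i : Fin n, ∃! u, u < i.succ ∧ G.Adj u i.succ

namespace IsRecursive

variable {G : SimpleGraph (Fin (n + 1))}

theorem eq_of_adj (hG : IsRecursive G) (v x y : Fin (n + 1)) (hx : x < v) (hy : y < v)
    (hxv : G.Adj x v) (hyv : G.Adj y v) : x = y := by
  obtain ⟨i, rfl⟩ := Fin.exists_succ_eq.2 (Fin.ne_zero_of_lt hx)
  exact (hG i).unique ⟨hx, hxv⟩ ⟨hy, hyv⟩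

theorem isTree (hG : IsRecursive G) : G.IsTree := by
  refine ⟨?_, isAcyclic_of_unique_smaller_neighbor hG.eq_of_adj⟩
  have h0 : ∀ v, G.Reachable 0 v := fun v => by
    induction v using WellFoundedLT.induction with
    | ind v ih =>
      rcases Fin.eq_zero_or_eq_succ v with rfl | ⟨i, rfl⟩
      · rfl
      · obtain ⟨u, ⟨hlt, hadj⟩, -⟩ := hG i
        exact (ih u hlt).trans hadj.reachable
  exact (connected_iff _).2 ⟨fun u v => (h0 u).symm.trans (h0 v), inferInstance⟩

theorem pairwise_support (hG : IsRecursive G) {v : Fin (n + 1)} (p : G.Walk 0 v) (hp : p.IsPath) :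
    p.support.Pairwise (· < ·) :=
  pairwise_support_of_isPath hG.eq_of_adj p hp (Or.inl Fin.zero_le)

theorem isIncreasingTree (hG : IsRecursive G) : IsIncreasingTree G 0 :=
  ⟨hG.isTree, fun _ _ p hp => hG.pairwise_support p hp⟩

theorem dist_eq (hG : IsRecursive G) {u w : Fin (n + 1)} (hlt : u < w) (h : G.Adj u w) :
    G.dist 0 w = G.dist 0 u + 1 := by
  have hconn := hG.isTree.connected
  obtain ⟨p, hp, hlen⟩ := hconn.exists_path_of_dist 0 w
  have hnil : ¬ p.Nil := fun hn => (Fin.ne_zero_of_lt hlt) hn.eq.symm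
  have hpu : p.penultimate = u := hG.eq_of_adj w _ _ (penultimate_lt (hG.pairwise_support p hp) hnil)
    hlt (p.adj_penultimate hnil) h
  have h1 : G.dist 0 p.penultimate + 1 ≤ p.length := by
    have := dist_le p.dropLast
    have h2 := congrArg Walk.length (p.concat_dropLast (p.adj_penultimate hnil))
    rw [Walk.length_concat] at h2
    omega
  have h3 := hconn.dist_triangle (u := 0) (v := u) (w := w)
  rw [dist_eq_one_iff_adj.2 h] at h3
  rw [hpu] at h1
  omega

theorem children_eq (hG : IsRecursive G) (v : Fin (n + 1)) :
    children G 0 v = {w | v < w ∧ G.Adj v w} := by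
  ext w
  refine ⟨fun ⟨h, hd⟩ => ⟨?_, h⟩, fun ⟨hlt, h⟩ => ⟨h, hG.dist_eq hlt h⟩⟩
  refine lt_of_le_of_ne (le_of_not_gt fun hlt => ?_) h.ne
  have := hG.dist_eq hlt h.symm
  omega

end IsRecursive

/-- A path that does not end at a leaf extends to a child of its end, and increase passes back to
the initial part; lengths are below `n`. -/
theorem IsIncreasingTree.pairwise_support {G : SimpleGraph (Fin n)} {r : Fin n}
    (hG : IsIncreasingTree G r) (v : Fin n) (p : G.Walk r v) (hp : p.IsPath) :
    p.support.Pairwise (· < ·) := by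
  obtain ⟨k, hk⟩ : ∃ k, p.length + k = n :=
    ⟨n - p.length, by have := hp.length_lt; rw [Fintype.card_fin] at this; omega⟩
  induction k generalizing v with
  | zero => have := hp.length_lt; rw [Fintype.card_fin] at this; omega
  | succ k ih =>
    by_cases hv : outDegree G r v = 0
    · exact hG.2 v hv p hp
    · obtain ⟨w, hvw, hd⟩ := Set.nonempty_of_ncard_ne_zero hv
      obtain ⟨q, hq, hlen⟩ := hG.1.connected.exists_path_of_dist r v
      obtain rfl := (hG.1.existsUnique_path r v).unique hp hq
      -- By uniqueness of paths `p` is shortest, so it cannot reach a vertex farther from the root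
      -- than `v`.
      have hw : w ∉ p.support := fun hmem => by
        have h1 := dist_le (p.takeUntil w hmem)
        have h2 := p.length_takeUntil_le_length hmem
        omega
      have := ih w (p.concat hvw) (hp.concat hw hvw) (by rw [Walk.length_concat]; omega)
      rw [Walk.support_concat, List.pairwise_append] at this
      exact this.1

theorem IsIncreasingTree.root_eq_zero {G : SimpleGraph (Fin (n + 1))} {r : Fin (n + 1)}
    (hG : IsIncreasingTree G r) : r = 0 := by
  obtain ⟨p, hp⟩ := (hG.1.connected.exists_isPath r 0)
  exact le_antisymm (le_of_pairwise_support (hG.pairwise_support 0 p hp) p.start_mem_support)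
    (Fin.zero_le _)

theorem IsIncreasingTree.isRecursive {G : SimpleGraph (Fin (n + 1))}
    (hG : IsIncreasingTree G 0) : IsRecursive G := by
  intro i
  obtain ⟨p, hp⟩ := (hG.1.connected.exists_isPath 0 i.succ)
  have hnil : ¬ p.Nil := fun hn => (Fin.succ_ne_zero i) hn.eq.symm
  refine ⟨p.penultimate, ⟨penultimate_lt (hG.pairwise_support _ p hp) hnil,
    p.adj_penultimate hnil⟩, fun u ⟨hlt, hadj⟩ => ?_⟩
  obtain ⟨q, hq⟩ := (hG.1.connected.exists_isPath 0 u)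
  have hmem : i.succ ∉ q.support := fun h =>
    (le_of_pairwise_support (hG.pairwise_support _ q hq) h).not_gt hlt
  rw [(hG.1.existsUnique_path 0 i.succ).unique hp (hq.concat hmem hadj), Walk.penultimate_concat]

namespace ParentMap

variable (p : ParentMap n)

/-- The parent of the vertex `i + 1`. -/
def parent (i : Fin n) : Fin (n + 1) := (p i).castLE (by omega)

theorem parent_lt (i : Fin n) : p.parent i < i.succ := by
  have := (p i).2
  simpa [parent, Fin.lt_def] using this

/-- The tree in which every `i + 1` is joined to its parent. -/
def toGraph : SimpleGraph (Fin (n + 1)) where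
  Adj a b := (∃ i, a = p.parent i ∧ b = i.succ) ∨ ∃ i, b = p.parent i ∧ a = i.succ
  symm := ⟨fun _ _ h => h.symm⟩
  loopless := ⟨by
    rintro a (⟨i, h, h'⟩ | ⟨i, h, h'⟩) <;> exact (p.parent_lt i).ne (h.symm.trans h')⟩

theorem lt_and_toGraph_adj_iff (u : Fin (n + 1)) (i : Fin n) :
    u < i.succ ∧ p.toGraph.Adj u i.succ ↔ u = p.parent i := by
  refine ⟨?_, ?_⟩
  · rintro ⟨hlt, ⟨j, rfl, hj⟩ | ⟨j, hj, rfl⟩⟩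
    · rw [Fin.succ_inj.1 hj]
    · exact absurd hlt (hj ▸ p.parent_lt j).not_gt
  · rintro rfl
    exact ⟨p.parent_lt i, Or.inl ⟨i, rfl, rfl⟩⟩

theorem isRecursive_toGraph : IsRecursive p.toGraph := fun i => by
  simp_rw [lt_and_toGraph_adj_iff]
  exact existsUnique_eq

theorem outDegree_toGraph (v : Fin (n + 1)) : outDegree p.toGraph 0 v = p.degree v := by
  have : {w | v < w ∧ p.toGraph.Adj v w} = Fin.succ '' {i | (p i : ℕ) = v} := by
    ext w
    rcases Fin.eq_zero_or_eq_succ w with rfl | ⟨i, rfl⟩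
    · simp
    · rw [Set.mem_ofPred_eq, lt_and_toGraph_adj_iff, (Fin.succ_injective n).mem_set_image]
      simp [parent, Fin.ext_iff, eq_comm]
  rw [outDegree, p.isRecursive_toGraph.children_eq, this,
    Set.ncard_image_of_injective _ (Fin.succ_injective n), degree, fibreCard_eq_ncard]

theorem toGraph_injective : Function.Injective (toGraph (n := n)) := by
  intro p q h
  funext i
  have := (p.lt_and_toGraph_adj_iff (p.parent i) i).2 rfl
  rw [h, lt_and_toGraph_adj_iff] at this
  simpa [parent, Fin.ext_iff] using this

theorem exists_toGraph_eq {G : SimpleGraph (Fin (n + 1))} (hG : IsRecursive G) :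
    ∃ p : ParentMap n, p.toGraph = G := by
  choose f hf hf' using hG
  have hlt : ∀ i, (f i : ℕ) < i + 1 := fun i => by simpa [Fin.lt_def] using (hf i).1
  set p : ParentMap n := fun i => ⟨f i, hlt i⟩ with hp
  have hpar : ∀ i, p.parent i = f i := fun i => rfl
  have key : ∀ a b : Fin (n + 1), a < b → (p.toGraph.Adj a b ↔ G.Adj a b) := fun a b hab => by
    obtain ⟨i, rfl⟩ := Fin.exists_succ_eq.2 (Fin.ne_zero_of_lt hab)
    have h := p.lt_and_toGraph_adj_iff a i
    rw [hpar] at h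
    exact ⟨fun h1 => h.1 ⟨hab, h1⟩ ▸ (hf i).2, fun h1 => (h.2 (hf' i a ⟨hab, h1⟩)).2⟩
  refine ⟨p, ?_⟩
  ext a b
  rcases lt_trichotomy a b with h | rfl | h
  · exact key a b h
  · simp
  · rw [adj_comm, key b a h, adj_comm]

end ParentMap

theorem numIncreasingTrees_succ (n m : ℕ) : numIncreasingTrees (n + 1) m =
    Nat.card {p : ParentMap n // ∀ v : Fin (n + 1), p.degree v ≤ m} := by
  refine (Nat.card_congr (Equiv.ofBijective (fun p => ⟨(p.1.toGraph, 0),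
    p.1.isRecursive_toGraph.isIncreasingTree,
    fun v => (p.1.outDegree_toGraph v).trans_le (p.2 v)⟩) ⟨?_, ?_⟩)).symm
  · intro p q h
    exact Subtype.ext (ParentMap.toGraph_injective (congrArg (fun T => T.1.1) h))
  · rintro ⟨⟨G, r⟩, hG, hdeg⟩
    obtain rfl := hG.root_eq_zero
    obtain ⟨p, rfl⟩ := ParentMap.exists_toGraph_eq hG.isRecursive
    exact ⟨⟨p, fun v => (p.outDegree_toGraph v).symm.trans_le (hdeg v)⟩, rfl⟩

end Trees

end IncTree

end

theorem theorem1 (m : ℕ) :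
    (∀ n : ℕ, 1 ≤ n →
      (IncTree.numIncreasingTrees n m : ℚ) =
        ∑ k ∈ Finset.range (n + 1),
          (-1) ^ k * IncTree.partialBell (n + k - 1) k
            (fun i => (IncTree.chiComplete m (i - 1)).eval (-1))) ∧
    (∀ s : ℕ, 1 ≤ s →
      (IncTree.chiComplete m s).eval (-1) =
        ∑ k ∈ Finset.Icc 1 s, (-1) ^ k * (k ! : ℚ) * IncTree.partialBell s k (IncTree.ones m)) := by
  refine ⟨fun n hn => ?_, fun s hs => IncTree.chiComplete_eval_neg_one_eq_sum_partialBell hs⟩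
  obtain ⟨n, rfl⟩ := Nat.exists_eq_add_of_le' hn
  rw [IncTree.numIncreasingTrees_succ, IncTree.card_degree_le_eq_sum_partialBell]
  refine Finset.sum_congr rfl fun k _ => ?_
  rw [show n + 1 + k - 1 = n + k by omega]
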